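/- Consider unlabeled rooted plane trees, i.e. trees with a root in which the children of each vertex are linearly ordered. A leaf is a vertex with no children, and the root of a tree is called $k$-protected if at least $k$ downward steps (each from a vertex to one of its children) are needed to get from the root to any leaf. For integers $k \ge 0$ and $n \ge 1$, let $r_k(n)$ be the number of rooted plane trees on $n$ vertices whose root is $k$-protected. Then, for every fixed integer $k \ge 0$, $$r_k(n) \sim \frac{9}{4^{1-k}+4+4^k}\cdot c_{n-1}\qquad (n\to\infty),$$ where $c_{m}=\frac{1}{m+1}\binom{2m}{m}$ denotes the $m$th Catalan number, and $a_n\sim b_n$ means $\lim_{n\to\infty} a_n/b_n=1$. -/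

import Mathlib

open Filter Topology

/-- Unlabeled rooted plane trees: a root together with an ordered sequence of `m` plane trees,
the subtrees hanging from the `m` children of the root (`m = 0` gives the one-vertex tree). -/
inductive PlaneTree : Type
  | node (m : ℕ) (child : Fin m → PlaneTree) : PlaneTree

namespace PlaneTree

/-- The number of vertices of a plane tree. -/
def numVertices : PlaneTree → ℕ
  | node _ child => 1 + ∑ i, (child i).numVertices

/-- `LeafAtDepth t d`: starting at the root of `t`, some leaf (a vertex without children)
is reached after exactly `d` downward steps. -/
inductive LeafAtDepth : PlaneTree → ℕ → Prop
  | leaf (child : Fin 0 → PlaneTree) : LeafAtDepth (node 0 child) 0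
  | step {m : ℕ} (child : Fin m → PlaneTree) (i : Fin m) {d : ℕ} (h : LeafAtDepth (child i) d) :
      LeafAtDepth (node m child) (d + 1)

/-- The root of `t` is `k`-protected: at least `k` downward steps are needed to reach any leaf. -/
def RootProtected (k : ℕ) (t : PlaneTree) : Prop :=
  ∀ d : ℕ, LeafAtDepth t d → k ≤ d

/-- `r k n` is the number of rooted plane trees on `n` vertices whose root is `k`-protected. -/
noncomputable def r (k n : ℕ) : ℕ :=
  Set.ncard {t : PlaneTree | t.numVertices = n ∧ t.RootProtected k}

end PlaneTree

/-! Write `R_k` for the generating function of trees with `k`-protected root. Detaching the leftmost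
subtree gives `R_0 = X + R_0 ^ 2` and `R_{k+1} = R_k (X + R_{k+1})`, so `R_k` is a rational function
of `X` and `R_0`. Multiplying by the conjugate under `R_0 ↦ 1 - R_0` makes the denominator a
polynomial (`genFun_add_two_mul`), and comparing coefficients gives a linear recurrence for `r k`
driven by Catalan numbers.

No singularity analysis is needed. Divided by `r 0 n`, the recurrence concerns the bounded ratio `r
k n / r 0 n`, and its coefficients converge because `r 0 (n - d) / r 0 n → 4⁻ᵈ`. The leading
coefficient dominates the others in the limit, so the ratio converges
(`tendsto_of_delay_recurrence`) to the value of the rational coefficient of `R_0` at `X = 1/4`. The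
cases `k = 0, 1` are direct, with limit 1. -/

namespace PlaneTree

/-! ### Leftmost-subtree decomposition and counting -/

/-- The one-vertex tree. -/
def leaf : PlaneTree := node 0 Fin.elim0

/-- Graft `a` onto the root of a tree as a new leftmost subtree. -/
def cons (a : PlaneTree) : PlaneTree → PlaneTree
  | node m child => node (m + 1) (Fin.cons a child)

/-- The number of plane trees on `n` vertices that satisfy `p`. -/
noncomputable def count (p : PlaneTree → Prop) (n : ℕ) : ℕ :=
  Set.ncard {t : PlaneTree | t.numVertices = n ∧ p t}

lemma node_zero (child : Fin 0 → PlaneTree) : node 0 child = leaf := by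
  rw [leaf, Subsingleton.elim child Fin.elim0]

lemma numVertices_leaf : leaf.numVertices = 1 := by
  simp [leaf, numVertices]

lemma numVertices_cons (a t : PlaneTree) :
    (cons a t).numVertices = a.numVertices + t.numVertices := by
  cases t
  simp only [cons, numVertices, Fin.sum_univ_succ, Fin.cons_zero, Fin.cons_succ]
  ring

lemma numVertices_pos (t : PlaneTree) : 0 < t.numVertices := by
  cases t
  simp only [numVertices]
  omega

lemma cons_injective2 : Function.Injective2 cons := by
  rintro a b ⟨m, c⟩ ⟨m', c'⟩ h
  simp only [cons, node.injEq, Nat.add_right_cancel_iff] at h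
  obtain ⟨rfl, h⟩ := h
  obtain ⟨h1, h2⟩ := Fin.cons_injective2 (eq_of_heq h)
  exact ⟨h1, by rw [h2]⟩

lemma cons_ne_leaf (a t : PlaneTree) : cons a t ≠ leaf := by
  cases t
  simp [cons, leaf]

lemma eq_leaf_or_cons (t : PlaneTree) : t = leaf ∨ ∃ a b, t = cons a b := by
  rcases t with ⟨_ | m, c⟩
  · exact Or.inl (node_zero c)
  · exact Or.inr ⟨c 0, node m (Fin.tail c), by simp [cons]⟩

lemma rootProtected_zero (t : PlaneTree) : t.RootProtected 0 := fun _ _ => Nat.zero_le _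

lemma leafAtDepth_leaf : LeafAtDepth leaf 0 := .leaf _

lemma not_rootProtected_succ_leaf (k : ℕ) : ¬ leaf.RootProtected (k + 1) := fun h =>
  absurd (h 0 leafAtDepth_leaf) (by omega)

lemma rootProtected_succ_node {k m : ℕ} (child : Fin (m + 1) → PlaneTree) :
    (node (m + 1) child).RootProtected (k + 1) ↔ ∀ i, (child i).RootProtected k := by
  constructor
  · intro h i d hd
    have := h (d + 1) (.step child i hd)
    omega
  · intro h d hd
    cases hd with
    | step _ i hd => exact Nat.succ_le_succ (h i _ hd)

/-- The remainder `t` is `leaf` exactly when `a` was the only child. This case is listed apart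
because `leaf` itself is not `k + 1`-protected; it produces the `X` in `X + R_{k+1}`. -/
lemma rootProtected_succ_cons (k : ℕ) (a t : PlaneTree) :
    (cons a t).RootProtected (k + 1) ↔
      a.RootProtected k ∧ (t = leaf ∨ t.RootProtected (k + 1)) := by
  rcases t with ⟨_ | m, c⟩
  · simp [cons, rootProtected_succ_node, node_zero]
  · have : node (m + 1) c ≠ leaf := by simp [leaf]
    simp only [cons, rootProtected_succ_node, Fin.forall_fin_succ (n := m + 1), Fin.cons_zero,
      Fin.cons_succ, this, false_or]

lemma setOf_cons_eq (p q : PlaneTree → Prop) (n : ℕ) :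
    {t | t.numVertices = n ∧ ∃ a b, t = cons a b ∧ p a ∧ q b} =
      ⋃ x ∈ (Finset.HasAntidiagonal.antidiagonal n : Finset (ℕ × ℕ)), (fun y : PlaneTree × PlaneTree => cons y.1 y.2) ''
        ({t | t.numVertices = x.1 ∧ p t} ×ˢ {t | t.numVertices = x.2 ∧ q t}) := by
  ext t
  simp only [Set.mem_ofPred_eq, Set.mem_iUnion, Set.mem_image, Set.mem_prod, Prod.exists,
    Finset.HasAntidiagonal.mem_antidiagonal]
  constructor
  · rintro ⟨h, a, b, rfl, ha, hb⟩
    exact ⟨_, _, (numVertices_cons a b).symm.trans h, a, b, ⟨⟨rfl, ha⟩, rfl, hb⟩, rfl⟩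
  · rintro ⟨i, j, h, a, b, ⟨⟨rfl, ha⟩, rfl, hb⟩, rfl⟩
    exact ⟨(numVertices_cons a b).trans h, a, b, rfl, ha, hb⟩

lemma finite_numVertices_eq (n : ℕ) : {t : PlaneTree | t.numVertices = n}.Finite := by
  induction n using Nat.strong_induction_on with
  | _ n ih =>
    have hsub : {t : PlaneTree | t.numVertices = n} ⊆ {leaf} ∪
        ⋃ i ∈ Finset.range n, ⋃ j ∈ Finset.range n,
          Set.image2 cons {t | t.numVertices = i} {t | t.numVertices = j} := by
      intro t ht
      rcases eq_leaf_or_cons t with rfl | ⟨a, b, rfl⟩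
      · exact Or.inl rfl
      · right
        have h1 := numVertices_pos a
        have h2 := numVertices_pos b
        simp only [Set.mem_ofPred_eq, numVertices_cons] at ht
        simp only [Set.mem_iUnion, Finset.mem_range]
        exact ⟨a.numVertices, by omega, b.numVertices, by omega, a, rfl, b, rfl, rfl⟩
    refine Set.Finite.subset ((Set.finite_singleton _).union ?_) hsub
    refine Set.Finite.biUnion (Finset.finite_toSet _) fun i hi => ?_
    refine Set.Finite.biUnion (Finset.finite_toSet _) fun j hj => ?_
    exact (ih i (by simpa using hi)).image2 _ (ih j (by simpa using hj))

lemma finite_setOf (p : PlaneTree → Prop) (n : ℕ) :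
    {t : PlaneTree | t.numVertices = n ∧ p t}.Finite :=
  (finite_numVertices_eq n).subset fun _ h => h.1

lemma count_cons (p q : PlaneTree → Prop) (n : ℕ) :
    count (fun t => ∃ a b, t = cons a b ∧ p a ∧ q b) n =
      ∑ x ∈ Finset.HasAntidiagonal.antidiagonal n, count p x.1 * count q x.2 := by
  have hinj : Function.Injective (fun y : PlaneTree × PlaneTree => cons y.1 y.2) := by
    rintro ⟨a, b⟩ ⟨c, d⟩ h
    obtain ⟨rfl, rfl⟩ := cons_injective2 h
    rfl
  have hunion := (Finset.finite_toSet (Finset.HasAntidiagonal.antidiagonal n)).ncard_biUnion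
    (s := fun x => (fun y : PlaneTree × PlaneTree => cons y.1 y.2) ''
      ({t | t.numVertices = x.1 ∧ p t} ×ˢ {t | t.numVertices = x.2 ∧ q t}))
    (fun x _ => ((finite_setOf p x.1).prod (finite_setOf q x.2)).image _) (by
      rintro ⟨i, j⟩ - ⟨i', j'⟩ - hne
      refine Set.disjoint_left.2 ?_
      rintro _ ⟨⟨a, b⟩, ⟨⟨rfl, -⟩, rfl, -⟩, rfl⟩ ⟨⟨c, d⟩, ⟨⟨rfl, -⟩, rfl, -⟩, h⟩
      obtain ⟨rfl, rfl⟩ := cons_injective2 h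
      exact hne rfl)
  rw [count, setOf_cons_eq]
  refine hunion.trans ?_
  rw [finsum_mem_coe_finset]
  refine Finset.sum_congr rfl fun x _ => ?_
  rw [Set.ncard_image_of_injective _ hinj, Set.ncard_prod]
  rfl

lemma count_or {p q : PlaneTree → Prop} (h : ∀ t, p t → ¬ q t) (n : ℕ) :
    count (fun t => p t ∨ q t) n = count p n + count q n := by
  rw [count, count, count, ← Set.ncard_union_eq _ (finite_setOf p n) (finite_setOf q n)]
  · congr 1
    ext t
    simp only [Set.mem_ofPred_eq, Set.mem_union]
    tauto
  · rw [Set.disjoint_left]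
    rintro t ⟨-, h1⟩ ⟨-, h2⟩
    exact h t h1 h2

lemma count_eq_leaf (n : ℕ) : count (· = leaf) n = if n = 1 then 1 else 0 := by
  split_ifs with h
  · have : {t : PlaneTree | t.numVertices = n ∧ t = leaf} = {leaf} := by
      ext t
      simp only [Set.mem_ofPred_eq, Set.mem_singleton_iff, and_iff_right_iff_imp]
      rintro rfl
      rw [numVertices_leaf, h]
    rw [count, this, Set.ncard_singleton]
  · have : {t : PlaneTree | t.numVertices = n ∧ t = leaf} = ∅ := by
      ext t
      simp only [Set.mem_ofPred_eq, Set.mem_empty_iff_false, iff_false, not_and]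
      rintro h1 rfl
      exact h (h1 ▸ numVertices_leaf)
    rw [count, this, Set.ncard_empty]

lemma r_eq_count (k n : ℕ) : r k n = count (RootProtected k) n := rfl

lemma r_zero_rec (n : ℕ) : r 0 n = (if n = 1 then 1 else 0) +
    ∑ x ∈ Finset.HasAntidiagonal.antidiagonal n, r 0 x.1 * r 0 x.2 := by
  simp only [r_eq_count]
  rw [← count_cons, ← count_eq_leaf, ← count_or]
  · congr 1
    ext t
    rcases eq_leaf_or_cons t with h | ⟨a, b, h⟩ <;> simp [h, rootProtected_zero]
  · rintro _ rfl ⟨a, b, h, -⟩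
    exact cons_ne_leaf a b h.symm

lemma r_succ_rec (k n : ℕ) : r (k + 1) n =
    ∑ x ∈ Finset.HasAntidiagonal.antidiagonal n, r k x.1 * ((if x.2 = 1 then 1 else 0) + r (k + 1) x.2) := by
  simp only [r_eq_count, ← count_eq_leaf]
  have h (i : ℕ) : count (· = leaf) i + count (RootProtected (k + 1)) i =
      count (fun t => t = leaf ∨ t.RootProtected (k + 1)) i :=
    (count_or (by rintro _ rfl; exact not_rootProtected_succ_leaf k) i).symm
  simp only [h]
  rw [← count_cons]
  congr 1
  ext t
  constructor
  · intro ht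
    rcases eq_leaf_or_cons t with rfl | ⟨a, b, rfl⟩
    · exact absurd ht (not_rootProtected_succ_leaf k)
    · exact ⟨a, b, rfl, (rootProtected_succ_cons k a b).1 ht⟩
  · rintro ⟨a, b, rfl, h⟩
    exact (rootProtected_succ_cons k a b).2 h

lemma r_le_r_zero (k n : ℕ) : r k n ≤ r 0 n :=
  Set.ncard_le_ncard (fun t h => ⟨h.1, rootProtected_zero t⟩) (finite_setOf _ n)

lemma r_zero_zero : r 0 0 = 0 := by
  have h : {t : PlaneTree | t.numVertices = 0 ∧ t.RootProtected 0} = ∅ := by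
    ext t
    have := numVertices_pos t
    simp only [Set.mem_ofPred_eq, Set.mem_empty_iff_false, iff_false, not_and]
    omega
  rw [r, h, Set.ncard_empty]

lemma r_zero_succ (n : ℕ) : r 0 (n + 1) = catalan n := by
  induction n using Nat.strong_induction_on with
  | _ n ih =>
    rw [r_zero_rec]
    rcases n with _ | n
    · simp [Finset.Nat.antidiagonal_succ, r_zero_zero]
    · rw [Finset.Nat.antidiagonal_succ_succ', catalan_succ']
      simp only [Finset.sum_cons, Finset.sum_map, r_zero_zero]
      simp
      refine Finset.sum_congr rfl fun x hx => ?_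
      rw [Finset.HasAntidiagonal.mem_antidiagonal] at hx
      rw [ih _ (by omega), ih _ (by omega)]

/-! ### Generating functions and the linear recurrence -/

open PowerSeries in
/-- The generating function of the trees with `k`-protected root, by number of vertices. -/
noncomputable def genFun (k : ℕ) : PowerSeries ℝ := PowerSeries.mk fun n => (r k n : ℝ)

open PowerSeries in
lemma coeff_genFun (k n : ℕ) : coeff n (genFun k) = (r k n : ℝ) := coeff_mk _ _

open PowerSeries in
lemma genFun_zero_eq : genFun 0 = X + genFun 0 * genFun 0 := by
  ext n
  rw [map_add, coeff_mul, coeff_X]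
  simp only [coeff_genFun]
  rw [r_zero_rec]
  push_cast
  rfl

open PowerSeries in
lemma genFun_succ_eq (k : ℕ) : genFun (k + 1) = genFun k * (X + genFun (k + 1)) := by
  ext n
  rw [coeff_mul]
  simp only [map_add, coeff_X, coeff_genFun]
  rw [r_succ_rec]
  push_cast
  rfl

-- The recursion is affine in the reciprocal, `1 / R_{k+1} = (1 / R_k - 1) / X`. Solving it creates
-- a geometric sum, which the factor `1 - X` clears.
open PowerSeries in
lemma genFun_mul_eq (k : ℕ) :
    genFun k * ((1 - X) * (1 - genFun 0) - X * (1 - X ^ k)) = (1 - X) * X ^ (k + 1) := by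
  induction k with
  | zero => linear_combination (1 - X) * genFun_zero_eq
  | succ k ih =>
    linear_combination ((1 - X) * (1 - genFun 0) - X * (1 - X ^ k)) * genFun_succ_eq k +
      (X + genFun (k + 1)) * ih

open PowerSeries in
lemma genFun_one : genFun 1 = genFun 0 - X := by
  have h : (1 - genFun 0) ≠ 0 := by
    intro h
    have := congrArg (coeff 0) h
    simp [-coeff_zero_eq_constantCoeff, coeff_genFun, r_zero_zero] at this
  refine mul_right_cancel₀ h ?_
  linear_combination genFun_succ_eq 0 - genFun_zero_eq

-- Multiply `genFun_mul_eq` at `k = j + 2` by the conjugate `(1 - X) R_0 - X (1 - X ^ k)`. Since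
-- `R_0 (1 - R_0) = X`, the product of the two conjugates is a polynomial, namely `X ^ 3` times the
-- factor on the left.
open PowerSeries in
lemma genFun_add_two_mul (j : ℕ) :
    genFun (j + 2) * (1 + X ^ j - 3 * X ^ (j + 1) + X ^ (2 * j + 3)) =
      X ^ j * ((1 - X) * ((1 - X) * genFun 0 - X * (1 - X ^ (j + 2)))) := by
  refine mul_right_cancel₀ (pow_ne_zero 3 (X_ne_zero (R := ℝ))) ?_
  linear_combination ((1 - X) * genFun 0 - X * (1 - X ^ (j + 2))) * genFun_mul_eq (j + 2) -
    genFun (j + 2) * (1 - X) ^ 2 * genFun_zero_eq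

open PowerSeries in
lemma r_add_two_rec (j n : ℕ) (hn : 2 * j + 5 ≤ n) :
    (r (j + 2) n : ℝ) + r (j + 2) (n - j) - 3 * r (j + 2) (n - (j + 1)) +
        r (j + 2) (n - (2 * j + 3)) =
      r 0 (n - j) - 2 * r 0 (n - (j + 1)) + r 0 (n - (j + 2)) := by
  have h : genFun (j + 2) + X ^ j * genFun (j + 2) - C (3 : ℝ) * (X ^ (j + 1) * genFun (j + 2)) +
        X ^ (2 * j + 3) * genFun (j + 2) =
      X ^ j * genFun 0 - C (2 : ℝ) * (X ^ (j + 1) * genFun 0) + X ^ (j + 2) * genFun 0 -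
        X ^ (j + 1) + X ^ (j + 2) + X ^ (2 * j + 3) - X ^ (2 * j + 4) := by
    have h3 : (C (3 : ℝ) : PowerSeries ℝ) = 3 := map_ofNat _ 3
    have h2 : (C (2 : ℝ) : PowerSeries ℝ) = 2 := map_ofNat _ 2
    rw [h2, h3]
    linear_combination genFun_add_two_mul j
  have := congrArg (coeff n) h
  simp only [map_add, map_sub, coeff_C_mul, coeff_X_pow_mul', coeff_X_pow, coeff_genFun] at this
  -- The pure powers of `X` have degree at most `2 * j + 4 < n`, so they contribute nothing.
  rw [if_pos (by omega), if_pos (by omega), if_pos (by omega), if_pos (by omega),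
    if_pos (by omega), if_pos (by omega), if_neg (by omega), if_neg (by omega), if_neg (by omega),
    if_neg (by omega)] at this
  linarith

end PlaneTree

/-! ### Ratios of Catalan numbers -/

lemma catalan_pos (n : ℕ) : 0 < catalan n := by
  have h := succ_mul_catalan_eq_centralBinom n
  have := Nat.centralBinom_pos n
  rw [← h] at this
  exact Nat.pos_of_mul_pos_left this

lemma add_two_mul_catalan_succ (n : ℕ) : (n + 2) * catalan (n + 1) = (4 * n + 2) * catalan n := by
  have h0 := succ_mul_catalan_eq_centralBinom n
  have h1 := succ_mul_catalan_eq_centralBinom (n + 1)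
  have h2 := Nat.succ_mul_centralBinom_succ n
  rw [← h0, ← h1] at h2
  refine Nat.eq_of_mul_eq_mul_left (Nat.succ_pos n) ?_
  rw [Nat.succ_eq_add_one]
  linarith

lemma tendsto_catalan_ratio :
    Tendsto (fun n => (catalan n : ℝ) / catalan (n + 1)) atTop (𝓝 (1 / 4)) := by
  have h (n : ℕ) : (catalan n : ℝ) / catalan (n + 1) = 1 / 4 + (3 / 8) * (1 / ((n : ℝ) + 1 / 2)) := by
    have h0 : (0 : ℝ) < catalan (n + 1) := by exact_mod_cast catalan_pos _
    have h1 : ((n : ℝ) + 2) * catalan (n + 1) = (4 * n + 2) * catalan n := by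
      exact_mod_cast add_two_mul_catalan_succ n
    have h2 : (0 : ℝ) < (n : ℝ) + 1 / 2 := by positivity
    have h3 : (catalan n : ℝ) = (n + 2) * catalan (n + 1) / (4 * n + 2) := by
      rw [h1]; field_simp
    rw [h3]
    field_simp
    ring
  simp only [h]
  have h1 : Tendsto (fun n : ℕ => 1 / ((n : ℝ) + 1 / 2)) atTop (𝓝 0) :=
    tendsto_const_nhds.div_atTop (tendsto_atTop_add_const_right _ _ tendsto_natCast_atTop_atTop)
  have h2 := (h1.const_mul (3 / 8)).const_add (1 / 4)
  rwa [mul_zero, add_zero] at h2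

namespace PlaneTree

lemma tendsto_r_zero_ratio (d : ℕ) :
    Tendsto (fun n => (r 0 (n - d) : ℝ) / r 0 n) atTop (𝓝 ((1 / 4) ^ d)) := by
  induction d with
  | zero =>
    refine tendsto_const_nhds.congr' ?_
    filter_upwards [eventually_ge_atTop 1] with n hn
    obtain ⟨n, rfl⟩ := Nat.exists_eq_add_of_le' hn
    have : (r 0 (n + 1) : ℝ) ≠ 0 := by
      rw [r_zero_succ]; exact_mod_cast (catalan_pos n).ne'
    simp [this]
  | succ d ih =>
    have h := (tendsto_catalan_ratio.comp (tendsto_sub_atTop_nat (d + 2))).mul ih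
    rw [pow_succ']
    refine h.congr' ?_
    filter_upwards [eventually_ge_atTop (d + 2)] with n hn
    obtain ⟨n, rfl⟩ := Nat.exists_eq_add_of_le' hn
    have h1 : n + (d + 2) - d = n + 1 + 1 := by omega
    have h2 : n + (d + 2) - (d + 1) = n + 1 := by omega
    rw [Function.comp_apply, Nat.add_sub_cancel, h1, h2, r_zero_succ, r_zero_succ]
    have h3 : (catalan (n + 1) : ℝ) ≠ 0 := by exact_mod_cast (catalan_pos _).ne'
    rw [div_mul_div_cancel₀ h3]

end PlaneTree

/-! ### Delay recurrences -/

/-- A bounded nonnegative sequence dominated, up to a null sequence, by a strict contraction of its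
own delays tends to zero. -/
lemma tendsto_zero_of_delay_le {ι : Type*} [Fintype ι] {e ε : ℕ → ℝ} {θ : ι → ℝ} {d : ι → ℕ} {B : ℝ}
    (he : ∀ n, 0 ≤ e n) (hB : ∀ n, e n ≤ B) (hθ : ∀ i, 0 ≤ θ i) (hθ1 : ∑ i, θ i < 1)
    (hε : Tendsto ε atTop (𝓝 0)) (hrec : ∀ᶠ n in atTop, e n ≤ ε n + ∑ i, θ i * e (n - d i)) :
    Tendsto e atTop (𝓝 0) := by
  have hbdd : IsBoundedUnder (· ≤ ·) atTop e := isBoundedUnder_of ⟨B, hB⟩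
  have hbdd' : IsBoundedUnder (· ≥ ·) atTop e := isBoundedUnder_of ⟨0, he⟩
  have hcob : IsCoboundedUnder (· ≤ ·) atTop e := hbdd'.isCoboundedUnder_le
  set l := limsup e atTop with hl
  have key : ∀ δ > 0, l ≤ δ + (∑ i, θ i) * (l + δ) := by
    intro δ hδ
    refine limsup_le_of_le hcob ?_
    have h1 : ∀ᶠ n in atTop, e n < l + δ := eventually_lt_of_limsup_lt (by linarith) hbdd
    have h2 : ∀ᶠ n in atTop, ∀ i, e (n - d i) < l + δ :=
      eventually_all.2 fun i => (tendsto_sub_atTop_nat (d i)).eventually h1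
    filter_upwards [hrec, h2, hε.eventually_lt_const hδ] with n hn1 hn2 hn3
    have : ∑ i, θ i * e (n - d i) ≤ ∑ i, θ i * (l + δ) :=
      Finset.sum_le_sum fun i _ => mul_le_mul_of_nonneg_left (hn2 i).le (hθ i)
    rw [← Finset.sum_mul] at this
    linarith
  have h0 : 0 ≤ ∑ i, θ i := Finset.sum_nonneg fun i _ => hθ i
  have hl0 : l ≤ 0 := by
    by_contra! hpos
    -- With `θ = ∑ i, θ i < 1`, this `δ` turns `key` into `l (1 - θ) ≤ l (1 - θ) (1 + θ) / 4`,
    -- impossible for `l > 0`.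
    have := key (l * (1 - ∑ i, θ i) / 4) (by have := sub_pos.2 hθ1; positivity)
    nlinarith [mul_pos hpos (sub_pos.2 hθ1)]
  refine tendsto_order.2 ⟨fun a ha => Eventually.of_forall fun n => ha.trans_le (he n),
    fun a ha => eventually_lt_of_limsup_lt (hl0.trans_lt ha) hbdd⟩

/-- A bounded solution of a linear delay recurrence with convergent coefficients, whose leading
coefficient dominates the others, converges. -/
lemma tendsto_of_delay_recurrence {ι : Type*} [Fintype ι] {s h : ℕ → ℝ} {w : ι → ℕ → ℝ}
    {d : ι → ℕ} {u H B : ℝ} {a : ι → ℝ} (hB : ∀ n, |s n| ≤ B)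
    (hw : ∀ i, Tendsto (w i) atTop (𝓝 (a i))) (hh : Tendsto h atTop (𝓝 H))
    (hrec : ∀ᶠ n in atTop, u * s n + ∑ i, w i n * s (n - d i) = h n) (hu : ∑ i, |a i| < u) :
    Tendsto s atTop (𝓝 (H / (u + ∑ i, a i))) := by
  have hu0 : 0 < u := (Finset.sum_nonneg fun i _ => abs_nonneg (a i)).trans_lt hu
  have hne : u + ∑ i, a i ≠ 0 := by
    have := neg_abs_le (∑ i, a i)
    have := Finset.abs_sum_le_sum_abs a Finset.univ
    linarith
  set L := H / (u + ∑ i, a i) with hL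
  have hLH : L * (u + ∑ i, a i) = H := div_mul_cancel₀ _ hne
  -- The error of replacing `w i n` and `h n` by their limits; it vanishes because `s` is bounded.
  set ε : ℕ → ℝ := fun n => |(h n - H) - ∑ i, (w i n - a i) * s (n - d i)| / u with hεdef
  have hε : Tendsto ε atTop (𝓝 0) := by
    have h1 : Tendsto (fun n => ∑ i, (w i n - a i) * s (n - d i)) atTop (𝓝 (∑ _i : ι, 0)) := by
      refine tendsto_finsetSum _ fun i _ => ?_
      have hz : Tendsto (fun n => w i n - a i) atTop (𝓝 0) := by
        simpa using (hw i).sub_const (a i)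
      exact hz.zero_mul_isBoundedUnder_le (isBoundedUnder_of ⟨B, fun n => by simpa using hB _⟩)
    have h2 := (((hh.sub_const H).sub h1).abs).div_const u
    simpa using h2
  have hmain : Tendsto (fun n => |s n - L|) atTop (𝓝 0) := by
    refine tendsto_zero_of_delay_le (θ := fun i => |a i| / u) (d := d) (B := B + |L|)
      (fun n => abs_nonneg _) (fun n => (abs_sub _ _).trans (by gcongr; exact hB n))
      (fun i => by positivity) ?_ hε ?_
    · rw [← Finset.sum_div]
      exact (div_lt_one hu0).2 hu
    · filter_upwards [hrec] with n hn
      have h1 : u * (s n - L) = ((h n - H) - ∑ i, (w i n - a i) * s (n - d i)) -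
          ∑ i, a i * (s (n - d i) - L) := by
        simp only [sub_mul, mul_sub, Finset.sum_sub_distrib, ← Finset.sum_mul]
        linear_combination hn - hLH
      have h2 : u * |s n - L| ≤ |(h n - H) - ∑ i, (w i n - a i) * s (n - d i)| +
          ∑ i, |a i| * |s (n - d i) - L| := by
        calc u * |s n - L| = |u * (s n - L)| := by rw [abs_mul, abs_of_pos hu0]
          _ ≤ _ := by
            rw [h1]
            refine (abs_sub _ _).trans ?_
            gcongr
            refine (Finset.abs_sum_le_sum_abs _ _).trans ?_
            simp only [abs_mul, le_refl]
      simp only [hεdef, div_mul_eq_mul_div, ← Finset.sum_div, ← add_div]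
      rw [le_div_iff₀ hu0]
      linarith
  have := (tendsto_zero_iff_abs_tendsto_zero _).2 hmain
  simpa using this.add_const L

/-! ### Limit of the ratio and conclusion -/

namespace PlaneTree

lemma tendsto_r_add_two_div (j : ℕ) :
    Tendsto (fun n => (r (j + 2) n : ℝ) / r 0 n) atTop
      (𝓝 ((9 / 16) * (1 / 4) ^ j / (1 + (1 / 4) ^ j - 3 * (1 / 4) ^ (j + 1) +
        (1 / 4) ^ (2 * j + 3)))) := by
  have hB (n : ℕ) : |(r (j + 2) n : ℝ) / r 0 n| ≤ 1 := by
    rw [abs_of_nonneg (by positivity)]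
    exact div_le_one_of_le₀ (by exact_mod_cast r_le_r_zero _ _) (by positivity)
  have hpos (n : ℕ) (hn : 1 ≤ n) : (r 0 n : ℝ) ≠ 0 := by
    obtain ⟨n, rfl⟩ := Nat.exists_eq_add_of_le' hn
    rw [r_zero_succ]
    exact_mod_cast (catalan_pos n).ne'
  have hh : Tendsto (fun n => (r 0 (n - j) : ℝ) / r 0 n - 2 * (r 0 (n - (j + 1)) / r 0 n) +
      r 0 (n - (j + 2)) / r 0 n) atTop (𝓝 ((9 / 16) * (1 / 4) ^ j)) := by
    have := ((tendsto_r_zero_ratio j).sub ((tendsto_r_zero_ratio (j + 1)).const_mul 2)).add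
      (tendsto_r_zero_ratio (j + 2))
    convert this using 2
    ring
  have hcancel (d n : ℕ) (hd : d < n) : (r 0 (n - d) : ℝ) / r 0 n *
      (r (j + 2) (n - d) / r 0 (n - d)) = r (j + 2) (n - d) / r 0 n := by
    have h1 := hpos n (by omega)
    have h2 := hpos (n - d) (by omega)
    field_simp
  have hrec (n : ℕ) (hn : 2 * j + 5 ≤ n) :
      (r (j + 2) n : ℝ) / r 0 n + r (j + 2) (n - j) / r 0 n -
        3 * (r (j + 2) (n - (j + 1)) / r 0 n) + r (j + 2) (n - (2 * j + 3)) / r 0 n =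
      (r 0 (n - j) : ℝ) / r 0 n - 2 * (r 0 (n - (j + 1)) / r 0 n) + r 0 (n - (j + 2)) / r 0 n := by
    have h1 := hpos n (by omega)
    have h2 := r_add_two_rec j n hn
    field_simp
    linarith
  rcases j with _ | j
  -- For `j = 0` the term with delay `j` merges with the leading one, so `u = 2`; kept apart, it
  -- would break the dominance condition.
  · have := tendsto_of_delay_recurrence (ι := Fin 2) (u := 2) (d := ![1, 3])
      (w := ![fun n => -3 * ((r 0 (n - 1) : ℝ) / r 0 n), fun n => (r 0 (n - 3) : ℝ) / r 0 n])
      (a := ![-3 * (1 / 4) ^ 1, (1 / 4) ^ 3]) hB ?_ hh ?_ ?_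
    · convert this using 2
      norm_num [Fin.sum_univ_two]
    · intro i
      fin_cases i
      · exact (tendsto_r_zero_ratio 1).const_mul _
      · exact tendsto_r_zero_ratio 3
    · filter_upwards [eventually_ge_atTop 5] with n hn
      have h := hrec n hn
      rw [← h]
      have h1 := hcancel 1 n (by omega)
      have h3 := hcancel 3 n (by omega)
      simp only [Fin.sum_univ_two, Matrix.cons_val_zero, Matrix.cons_val_one]
      rw [mul_assoc, h1, h3]
      simp only [Nat.sub_zero, Nat.zero_add, Nat.mul_zero]
      ring
    · norm_num [Fin.sum_univ_two, abs_of_pos, abs_of_neg]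
  · have := tendsto_of_delay_recurrence (ι := Fin 3) (u := 1) (d := ![j + 1, j + 2, 2 * j + 5])
      (w := ![fun n => (r 0 (n - (j + 1)) : ℝ) / r 0 n,
        fun n => -3 * ((r 0 (n - (j + 2)) : ℝ) / r 0 n),
        fun n => (r 0 (n - (2 * j + 5)) : ℝ) / r 0 n])
      (a := ![(1 / 4) ^ (j + 1), -3 * (1 / 4) ^ (j + 2), (1 / 4) ^ (2 * j + 5)]) hB ?_ hh ?_ ?_
    · convert this using 2
      simp only [Fin.sum_univ_three, Matrix.cons_val]
      ring
    · intro i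
      fin_cases i
      · exact tendsto_r_zero_ratio _
      · exact (tendsto_r_zero_ratio _).const_mul _
      · exact tendsto_r_zero_ratio _
    · filter_upwards [eventually_ge_atTop (2 * (j + 1) + 5)] with n hn
      have h := hrec n hn
      rw [← h]
      have h1 := hcancel (j + 1) n (by omega)
      have h2 := hcancel (j + 2) n (by omega)
      have h3 := hcancel (2 * j + 5) n (by omega)
      simp only [Fin.sum_univ_three, Matrix.cons_val]
      rw [mul_assoc (-3), h1, h2, h3, show 2 * (j + 1) + 3 = 2 * j + 5 by ring]
      ring
    · simp only [Fin.sum_univ_three, Matrix.cons_val, abs_mul, abs_pow]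
      have h1 : ((1 : ℝ) / 4) ^ j ≤ 1 := pow_le_one₀ (by norm_num) (by norm_num)
      have h2 : ((1 : ℝ) / 4) ^ (2 * j) ≤ 1 := pow_le_one₀ (by norm_num) (by norm_num)
      rw [abs_of_pos (by norm_num : (0 : ℝ) < 1 / 4), abs_of_neg (by norm_num : (-3 : ℝ) < 0)]
      simp only [pow_succ]
      norm_num at *
      linarith

lemma tendsto_r_div_r_zero (k : ℕ) :
    Tendsto (fun n => (r k n : ℝ) / r 0 n) atTop
      (𝓝 (9 / ((4 : ℝ) ^ (1 - (k : ℤ)) + 4 + (4 : ℝ) ^ k))) := by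
  have hone : Tendsto (fun n => (r 0 n : ℝ) / r 0 n) atTop (𝓝 1) := by
    simpa using tendsto_r_zero_ratio 0
  match k with
  | 0 =>
    convert hone using 2
    norm_num
  | 1 =>
    have h : Tendsto (fun n => (r 1 n : ℝ) / r 0 n) atTop (𝓝 1) := by
      refine hone.congr' ?_
      filter_upwards [eventually_ge_atTop 2] with n hn
      have h := congrArg (PowerSeries.coeff n) genFun_one
      rw [map_sub, coeff_genFun, coeff_genFun, PowerSeries.coeff_X, if_neg (by omega), sub_zero] at h
      rw [h]
    convert h using 2
    norm_num
  | j + 2 =>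
    convert tendsto_r_add_two_div j using 2
    have h : (4 : ℝ) ^ (1 - ((j + 2 : ℕ) : ℤ)) = 1 / (4 * 4 ^ j) := by
      rw [show (1 : ℤ) - ((j + 2 : ℕ) : ℤ) = -((j + 1 : ℕ) : ℤ) by push_cast; ring, zpow_neg,
        zpow_natCast, pow_succ, one_div, mul_comm]
    rw [h]
    have hd : (1 : ℝ) + (1 / 4) ^ j - 3 * (1 / 4) ^ (j + 1) + (1 / 4) ^ (2 * j + 3) =
        (1 / 16) * (1 / 4) ^ j * (1 / (4 * 4 ^ j) + 4 + 4 ^ (j + 2)) := by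
      simp only [one_div, inv_pow]
      field_simp
      ring
    rw [hd]
    field_simp

end PlaneTree

theorem theorem4 (k : ℕ) :
    Tendsto
      (fun n : ℕ =>
        (PlaneTree.r k n : ℝ) /
          (9 / ((4 : ℝ) ^ (1 - (k : ℤ)) + 4 + (4 : ℝ) ^ k) * (catalan (n - 1) : ℝ)))
      atTop (𝓝 1) := by
  have hc : (9 : ℝ) / ((4 : ℝ) ^ (1 - (k : ℤ)) + 4 + (4 : ℝ) ^ k) ≠ 0 := by positivity
  have h := (PlaneTree.tendsto_r_div_r_zero k).div_const
    (9 / ((4 : ℝ) ^ (1 - (k : ℤ)) + 4 + (4 : ℝ) ^ k))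
  rw [div_self hc] at h
  refine h.congr' ?_
  filter_upwards [eventually_ge_atTop 1] with n hn
  obtain ⟨n, rfl⟩ := Nat.exists_eq_add_of_le' hn
  rw [PlaneTree.r_zero_succ, Nat.add_sub_cancel, div_div, mul_comm]
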